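/- Let $b(z)=b_0+b_1z+\cdots+b_qz^q$ with $b_i\in\mathbb{R}^{n\times n}$, $b_q\neq 0$, and $\det b(z)\neq 0$ for all $z\in\mathbb{C}$ with $|z|=1$. A Wiener–Hopf factorisation (WHF) of $b$ is a factorisation $b(z)=p(z)s(z)f(z)$ in which $p(z)=p_0+p_1z+\cdots$ is a real $n\times n$ polynomial matrix with $\det p(z)\ne0$ for $|z|\le 1$; $s(z)=\mathrm{diag}(z^{\kappa_1},\dots,z^{\kappa_n})$ with integers $\kappa_1\ge\cdots\ge\kappa_n$ (the partial indices); and $f(z)=f_0+f_1z^{-1}+\cdots$ is a real $n\times n$ matrix whose entries are polynomials in $z^{-1}$, with $\det f(z)\neq0$ for $|z|\ge1$ and $\det f_0\neq 0$. Suppose that $b$ has a WHF with partial indices $(\kappa+1,\dots,\kappa+1,\kappa,\dots,\kappa)$, where $\kappa\ge0$, $0\le k\le n-1$, and exactly the first $k$ indices equal $\kappa+1$. Then every WHF of $b$ has these partial indices, and the following hold. (a) Let $k=0$. Then $\kappa\le q$, and every WHF of $b$ satisfies $\deg p=q-\kappa$ and $f(z)=f_0+f_1z^{-1}+\cdots+f_\kappa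 z^{-\kappa}$. There is exactly one WHF of $b$ with $p_0=I_n$. (b) Let $k\neq0$. Then $\kappa+1\le q$. In every WHF of $b$, the first $k$ columns of $p$ have degree at most $q-\kappa-1$ and the last $n-k$ columns have degree at most $q-\kappa$; at least one column attains its bound, and all columns attain their bounds if $b_q$ is non-singular. Moreover $f(z)=f_0+f_1z^{-1}+\cdots+f_{\kappa+1}z^{-\kappa-1}$, and the last $n-k$ rows of $f_{\kappa+1}$ are zero. Partition $n\times n$ matrices according to $n=k+(n-k)$ and call a WHF canonical if $$p_0=\begin{pmatrix}I_k&0\\ p_{0,21}&I_{n-k}\end{pmatrix},\qquad p_{1,12}=0 .$$ Then $b$ has at most one canonical WHF. For each WHF of $b$, the block $p_{0,11}$ of that WHF is invertible if and only if $b$ has exactly one canonical WHF. Finally, the rows of $b$ can always be permuted so that the resulting polynomial matrix has exactly one canonical WHF. -/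

import Mathlib

open Polynomial

/-- The coefficient matrix `a_m` of a matrix polynomial `a(x) = a_0 + a_1 x + a_2 x² + ⋯`. -/
noncomputable def coeffMatrix {n : ℕ} (a : Matrix (Fin n) (Fin n) ℝ[X]) (m : ℕ) :
    Matrix (Fin n) (Fin n) ℝ :=
  a.map fun e => e.coeff m

/-- The value of a real matrix polynomial at a complex point. -/
noncomputable def evalMatrix {n : ℕ} (a : Matrix (Fin n) (Fin n) ℝ[X]) (z : ℂ) :
    Matrix (Fin n) (Fin n) ℂ :=
  a.map fun e => aeval z e

/-- `b(z) = b_0 + b_1 z + ⋯ + b_q z^q` with `b_q ≠ 0`. -/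
def HasMatrixDegree {n : ℕ} (b : Matrix (Fin n) (Fin n) ℝ[X]) (q : ℕ) : Prop :=
  (∀ m : ℕ, q < m → coeffMatrix b m = 0) ∧ coeffMatrix b q ≠ 0

/-- Data `(p, s, f)` of a factorisation: `p` is a polynomial matrix in `z`,
`s(z) = diag (z ^ ind 0, …, z ^ ind (n - 1))`, and the entries of `f` are polynomials in the
variable `z⁻¹`, so that `f(z) = f_0 + f_1 z⁻¹ + ⋯` with `f_m = coeffMatrix f m`. -/
structure FactorTriple (n : ℕ) where
  p : Matrix (Fin n) (Fin n) ℝ[X]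
  ind : Fin n → ℤ
  f : Matrix (Fin n) (Fin n) ℝ[X]

/-- The product `p(z) s(z) f(z)` as a matrix of Laurent polynomials in `z`. -/
noncomputable def FactorTriple.prod {n : ℕ} (W : FactorTriple n) :
    Matrix (Fin n) (Fin n) (LaurentPolynomial ℝ) :=
  W.p.map (fun e => toLaurent e) *
    Matrix.diagonal (fun i => (LaurentPolynomial.T (W.ind i) : LaurentPolynomial ℝ)) *
    W.f.map (fun e => LaurentPolynomial.invert (toLaurent e))

/-- `W` is a (left) Wiener–Hopf factorisation of `b`: `b(z) = p(z) s(z) f(z)`, where the partial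
indices are non-increasing, `p` has no zeros inside or on the unit circle, and `f` has no zeros on
or outside the unit circle, including the point at infinity. (Poles are excluded by `p` being a
polynomial in `z` and `f` a polynomial in `z⁻¹`.) -/
structure IsWHF {n : ℕ} (b : Matrix (Fin n) (Fin n) ℝ[X]) (W : FactorTriple n) : Prop where
  factor : b.map (fun e => toLaurent e) = W.prod
  antitone_ind : Antitone W.ind
  p_no_zero : ∀ z : ℂ, ‖z‖ ≤ 1 → (evalMatrix W.p z).det ≠ 0
  f_no_zero : ∀ z : ℂ, 1 ≤ ‖z‖ → (evalMatrix W.f z⁻¹).det ≠ 0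
  f_no_zero_infty : (coeffMatrix W.f 0).det ≠ 0

/-- The partial indices `(κ + 1, …, κ + 1, κ, …, κ)`, with `k` entries equal to `κ + 1`. -/
def indexPair (n κ k : ℕ) : Fin n → ℤ :=
  fun i => if (i : ℕ) < k then (κ : ℤ) + 1 else κ

/-- The leading principal `k × k` block of a matrix. -/
def leadingBlock {n : ℕ} (k : ℕ) (hk : k ≤ n) (A : Matrix (Fin n) (Fin n) ℝ) :
    Matrix (Fin k) (Fin k) ℝ :=
  A.submatrix (Fin.castLE hk) (Fin.castLE hk)

/-- The normalisation `p_0 = [[I_k, 0], [*, I_{n-k}]]` and `p_{1,12} = 0`, blocks being taken with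
respect to the partition `n = k + (n - k)`. -/
structure IsNormalised {n : ℕ} (k : ℕ) (p : Matrix (Fin n) (Fin n) ℝ[X]) : Prop where
  p0_11 : ∀ i j : Fin n, (i : ℕ) < k → (j : ℕ) < k →
    coeffMatrix p 0 i j = if i = j then 1 else 0
  p0_12 : ∀ i j : Fin n, (i : ℕ) < k → k ≤ (j : ℕ) → coeffMatrix p 0 i j = 0
  p0_22 : ∀ i j : Fin n, k ≤ (i : ℕ) → k ≤ (j : ℕ) →
    coeffMatrix p 0 i j = if i = j then 1 else 0
  p1_12 : ∀ i j : Fin n, (i : ℕ) < k → k ≤ (j : ℕ) → coeffMatrix p 1 i j = 0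

/-! If p s f = p' s' f' are two factorisations of b, then p'⁻¹p = s' f' f⁻¹ s⁻¹. Poles of the left
side lie outside the closed unit disc, those of the right side inside the open disc, so U = p'⁻¹p is
a polynomial matrix, and regularity of f' f⁻¹ at infinity bounds the degree of U_ij by κ'_i − κ_j
(`exists_transition`). If some index of s exceeded its counterpart in s', these bounds would give U
a block of zeros large enough to make it singular; hence the indices agree (`ind_eq`).

For indices κ+1 and κ only, U = U_0 + zU_1 with U_0 block upper triangular and U_1 supported in the
upper right block. Conversely, such U with an inverse of the same shape carry factorisations to
factorisations (`exists_p_mul`). A canonical factorisation is thus a representative of an orbit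
under p_0 ↦ p_0U_0, p_1 ↦ p_1U_0 + p_0U_1. The factor U_0 can normalise p_0 exactly when p_{0,11} is
invertible, U_1 then removes p_{1,12}, and no freedom is left. Since p_0 is invertible, a row
permutation makes p_{0,11} invertible.

The degree bounds come from regularity at z = 0 of s f = p⁻¹b and, after z ↦ z⁻¹ and multiplication
by z^q, of p s = b f⁻¹. -/

open LaurentPolynomial in
/-- Substitution of `z⁻¹` for the variable, as a ring homomorphism into Laurent polynomials. -/
noncomputable def toLaurentInv : ℝ[X] →+* LaurentPolynomial ℝ :=
  (invert : LaurentPolynomial ℝ ≃ₐ[ℝ] LaurentPolynomial ℝ).toRingEquiv.toRingHom.comp toLaurent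

/-! ### Polynomials in z and in z⁻¹ inside the Laurent ring -/

namespace LaurentPolynomial

theorem toLaurentInv_apply (f : ℝ[X]) : toLaurentInv f = invert (toLaurent f) := rfl

theorem invert_toLaurentInv (f : ℝ[X]) : invert (toLaurentInv f) = toLaurent f :=
  involutive_invert _

theorem toLaurentInv_injective : Function.Injective toLaurentInv := fun _ _ h =>
  toLaurent_injective (invert.injective h)

theorem coeff_T_mul (a n : ℤ) (x : LaurentPolynomial ℝ) :
    (T a * x).coeff n = x.coeff (n - a) := by
  induction x using LaurentPolynomial.induction_on' with
  | add p q hp hq => simp only [mul_add, AddMonoidAlgebra.coeff_add, Finsupp.add_apply, hp, hq]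
  | C_mul_T m c =>
    rw [mul_left_comm, ← T_add, ← single_eq_C_mul_T, ← single_eq_C_mul_T,
      AddMonoidAlgebra.coeff_single, AddMonoidAlgebra.coeff_single, Finsupp.single_apply,
      Finsupp.single_apply]
    exact if_congr (by omega) rfl rfl

theorem coeff_toLaurent_natCast (f : ℝ[X]) (n : ℕ) : (toLaurent f).coeff (n : ℤ) = f.coeff n := by
  induction f using Polynomial.induction_on' with
  | add p q hp hq => simp only [map_add, AddMonoidAlgebra.coeff_add, Finsupp.add_apply, hp, hq,
      Polynomial.coeff_add]
  | monomial m c =>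
    rw [toLaurent_C_mul_T, ← single_eq_C_mul_T, AddMonoidAlgebra.coeff_single,
      Finsupp.single_apply, coeff_monomial]
    exact if_congr (by omega) rfl rfl

theorem coeff_toLaurent_of_neg (f : ℝ[X]) {n : ℤ} (hn : n < 0) : (toLaurent f).coeff n = 0 := by
  induction f using Polynomial.induction_on' with
  | add p q hp hq => simp only [map_add, AddMonoidAlgebra.coeff_add, Finsupp.add_apply, hp, hq,
      add_zero]
  | monomial m c =>
    rw [toLaurent_C_mul_T, ← single_eq_C_mul_T, AddMonoidAlgebra.coeff_single,
      Finsupp.single_apply, if_neg (by omega)]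

theorem T_neg_mul_cancel (a : ℤ) (x : LaurentPolynomial ℝ) : T (-a) * (T a * x) = x := by
  rw [← mul_assoc, ← T_add, neg_add_cancel, T_zero, one_mul]

theorem exists_eq_toLaurent_of_coeff_neg {x : LaurentPolynomial ℝ}
    (hx : ∀ n : ℤ, n < 0 → x.coeff n = 0) : ∃ h : ℝ[X], x = toLaurent h := by
  obtain ⟨N, g, hg⟩ := exists_T_pow x
  have hd : X ^ N ∣ g := by
    rw [X_pow_dvd_iff]
    intro d hd
    rw [← coeff_toLaurent_natCast, hg, ← T_mul, coeff_T_mul]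
    exact hx _ (by omega)
  obtain ⟨h, rfl⟩ := hd
  refine ⟨h, ?_⟩
  rw [map_mul, toLaurent_X_pow, ← T_mul] at hg
  exact ((isUnit_T (R := ℝ) N).mul_left_cancel hg).symm

theorem exists_T_mul_toLaurentInv_eq {a : ℤ} {g : ℝ[X]}
    (hg : ∀ m : ℕ, a < m → g.coeff m = 0) : ∃ h : ℝ[X], T a * toLaurentInv g = toLaurent h := by
  refine exists_eq_toLaurent_of_coeff_neg fun n hn => ?_
  rw [coeff_T_mul, toLaurentInv_apply, invert_apply]
  rcases lt_or_ge (-(n - a)) 0 with h | h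
  · exact coeff_toLaurent_of_neg g h
  · obtain ⟨m, hm⟩ := Int.eq_ofNat_of_zero_le h
    rw [hm, coeff_toLaurent_natCast]
    exact hg m (by omega)

theorem exists_T_mul_toLaurent_eq {a : ℤ} {g : ℝ[X]}
    (hg : ∀ m : ℕ, -a < m → g.coeff m = 0) : ∃ h : ℝ[X], T a * toLaurent g = toLaurentInv h := by
  obtain ⟨h, hh⟩ := exists_T_mul_toLaurentInv_eq hg
  refine ⟨h, ?_⟩
  rw [toLaurentInv_apply, ← hh, map_mul, invert_T, neg_neg, invert_toLaurentInv]

theorem coeff_eq_zero_of_T_mul_toLaurentInv_eq {a : ℤ} {g h : ℝ[X]}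
    (H : T a * toLaurentInv g = toLaurent h) {m : ℕ} (hm : a < m) : g.coeff m = 0 := by
  have := congrArg (fun x : LaurentPolynomial ℝ => x.coeff (a - m)) H
  simp only [coeff_T_mul, toLaurentInv_apply, invert_apply] at this
  rw [coeff_toLaurent_of_neg h (by omega), show -(a - (m : ℤ) - a) = m by ring,
    coeff_toLaurent_natCast] at this
  exact this

theorem coeff_eq_coeff_of_T_mul_toLaurentInv_eq {a : ℤ} {g h : ℝ[X]}
    (H : T a * toLaurentInv g = toLaurent h) {l m : ℕ} (hm : (l : ℤ) + m = a) :
    h.coeff l = g.coeff m := by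
  have := congrArg (fun x : LaurentPolynomial ℝ => x.coeff l) H
  simp only [coeff_T_mul, toLaurentInv_apply, invert_apply] at this
  rw [show -((l : ℤ) - a) = m by omega, coeff_toLaurent_natCast, coeff_toLaurent_natCast] at this
  exact this.symm

/-- A polynomial with nonzero constant term is coprime to every power of `X`, so it cannot cancel a
pole of `x` at 0. This is the algebraic substitute for regularity at 0, and after inversion at
infinity. -/
theorem exists_eq_toLaurent_of_toLaurent_mul {c g : ℝ[X]} {x : LaurentPolynomial ℝ}
    (hc : c.coeff 0 ≠ 0) (H : toLaurent c * x = toLaurent g) : ∃ h : ℝ[X], x = toLaurent h := by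
  obtain ⟨N, y, hy⟩ := exists_T_pow x
  have e : c * y = g * X ^ N := by
    apply toLaurent_injective
    rw [map_mul, map_mul, hy, toLaurent_X_pow, ← mul_assoc, H]
  have hco : IsCoprime (X ^ N) c := by
    refine IsCoprime.pow_left ((Irreducible.coprime_iff_not_dvd irreducible_X).2 ?_)
    rwa [X_dvd_iff]
  obtain ⟨h, rfl⟩ := hco.dvd_of_dvd_mul_left (Dvd.intro_left g e.symm)
  refine ⟨h, ?_⟩
  rw [map_mul, toLaurent_X_pow, ← T_mul] at hy
  rw [T_mul, T_mul] at hy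
  exact ((isUnit_T (R := ℝ) N).mul_right_cancel hy).symm

theorem exists_eq_toLaurentInv_of_toLaurentInv_mul {c g : ℝ[X]} {x : LaurentPolynomial ℝ}
    (hc : c.coeff 0 ≠ 0) (H : toLaurentInv c * x = toLaurentInv g) :
    ∃ h : ℝ[X], x = toLaurentInv h := by
  have H' := congrArg invert H
  rw [map_mul, invert_toLaurentInv, invert_toLaurentInv] at H'
  obtain ⟨h, hh⟩ := exists_eq_toLaurent_of_toLaurent_mul hc H'
  exact ⟨h, by rw [toLaurentInv_apply, ← hh]; exact (involutive_invert x).symm⟩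

/-- If `c` has its zeros off the closed unit disc and `d(z⁻¹)` has its zeros in the open unit disc,
then a Laurent polynomial `N(z) d(z⁻¹) zᵃ = c(z) m(z⁻¹)` forces `c ∣ N`. -/
theorem dvd_of_toLaurent_mul_toLaurentInv {c d N m : ℝ[X]} {a : ℤ}
    (hc : ∀ z : ℂ, ‖z‖ ≤ 1 → aeval z c ≠ 0) (hd : ∀ z : ℂ, 1 ≤ ‖z‖ → aeval z⁻¹ d ≠ 0)
    (H : toLaurent N * (T a * toLaurentInv d) = toLaurent c * toLaurentInv m) : c ∣ N := by
  -- Multiplying by z^(deg d) turns d(z⁻¹) into `d.reverse`; the extra z^k clears the remaining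
  -- negative powers and is harmless because c does not vanish at 0.
  obtain ⟨k, y, hy⟩ := exists_T_pow (T (-a) * toLaurentInv m * T d.natDegree)
  have e : N * (d.reverse * X ^ k) = c * y := by
    apply toLaurent_injective
    rw [map_mul, map_mul, map_mul, hy, toLaurent_X_pow, toLaurent_reverse, ← toLaurentInv_apply]
    have := congrArg (fun x => T (-a) * x * T (d.natDegree : ℤ) * T (k : ℤ)) H
    rw [mul_left_comm (toLaurent N), T_neg_mul_cancel] at this
    linear_combination this
  have hco : IsCoprime c (d.reverse * X ^ k) := by
    rw [isCoprime_iff_aeval_ne_zero_of_isAlgClosed ℝ ℂ]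
    intro z
    by_contra! hz
    have h1 : 1 < ‖z‖ := by
      by_contra! h
      exact hc z h hz.1
    have hz0 : z ≠ 0 := norm_pos_iff.1 (by linarith)
    have h2 : aeval z d.reverse = 0 := by
      have := hz.2
      rw [map_mul, map_pow, aeval_X] at this
      exact (mul_eq_zero.1 this).resolve_right (pow_ne_zero _ hz0)
    let _ : Invertible z⁻¹ := invertibleOfNonzero (inv_ne_zero hz0)
    have h3 : (⅟(z⁻¹) : ℂ) = z := by rw [invOf_eq_inv, inv_inv]
    have := (eval₂_reverse_eq_zero_iff (algebraMap ℝ ℂ) z⁻¹ d).1 (by rw [h3]; exact h2)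
    exact hd z h1.le this
  exact hco.dvd_of_dvd_mul_right (Dvd.intro y e.symm)

end LaurentPolynomial

/-! ### Coefficient matrices and the diagonal factor -/

theorem det_evalMatrix {n : ℕ} (a : Matrix (Fin n) (Fin n) ℝ[X]) (z : ℂ) :
    (evalMatrix a z).det = aeval z a.det :=
  ((aeval z).map_det a).symm

theorem coeffMatrix_zero_eq {n : ℕ} (a : Matrix (Fin n) (Fin n) ℝ[X]) :
    coeffMatrix a 0 = constantCoeff.mapMatrix a := rfl

theorem det_coeffMatrix_zero {n : ℕ} (a : Matrix (Fin n) (Fin n) ℝ[X]) :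
    (coeffMatrix a 0).det = a.det.coeff 0 := by
  rw [coeffMatrix_zero_eq, ← RingHom.map_det]
  rfl

theorem coeffMatrix_zero_mul {n : ℕ} (a c : Matrix (Fin n) (Fin n) ℝ[X]) :
    coeffMatrix (a * c) 0 = coeffMatrix a 0 * coeffMatrix c 0 := by
  simp only [coeffMatrix_zero_eq, map_mul]

theorem coeffMatrix_apply {n : ℕ} (a : Matrix (Fin n) (Fin n) ℝ[X]) (m : ℕ) (i j : Fin n) :
    coeffMatrix a m i j = (a i j).coeff m := rfl

theorem coeffMatrix_one_mul {n : ℕ} (a c : Matrix (Fin n) (Fin n) ℝ[X]) :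
    coeffMatrix (a * c) 1 =
      coeffMatrix a 0 * coeffMatrix c 1 + coeffMatrix a 1 * coeffMatrix c 0 := by
  ext i j
  simp only [coeffMatrix_apply, Matrix.mul_apply, Matrix.add_apply, finsetSum_coeff,
    ← Finset.sum_add_distrib]
  refine Finset.sum_congr rfl fun l _ => ?_
  rw [coeff_mul, Finset.Nat.antidiagonal_succ]
  simp

theorem Matrix.mul_left_cancel_of_det_ne_zero {R m : Type*} [CommRing R] [IsDomain R] [Fintype m]
    [DecidableEq m] {A B C : Matrix m m R} (hA : A.det ≠ 0) (h : A * B = A * C) : B = C := by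
  have := congrArg (A.adjugate * ·) h
  simp only [← mul_assoc, Matrix.adjugate_mul, Matrix.smul_mul, one_mul] at this
  exact smul_right_injective _ hA this

/-- The diagonal factor `diag (z ^ ind 0, …, z ^ ind (n - 1))`. -/
noncomputable def diagT {n : ℕ} (ind : Fin n → ℤ) :
    Matrix (Fin n) (Fin n) (LaurentPolynomial ℝ) :=
  Matrix.diagonal fun i => LaurentPolynomial.T (ind i)

theorem diagT_mul_neg {n : ℕ} (ind : Fin n → ℤ) : diagT ind * diagT (-ind) = 1 := by
  rw [diagT, diagT, Matrix.diagonal_mul_diagonal, ← Matrix.diagonal_one]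
  congr 1
  ext1 i
  rw [← LaurentPolynomial.T_add, Pi.neg_apply, add_neg_cancel, LaurentPolynomial.T_zero]

theorem diagT_neg_mul {n : ℕ} (ind : Fin n → ℤ) : diagT (-ind) * diagT ind = 1 := by
  simpa using diagT_mul_neg (-ind)

theorem diagT_mul_apply {n : ℕ} (ind : Fin n → ℤ)
    (A : Matrix (Fin n) (Fin n) (LaurentPolynomial ℝ)) (i j : Fin n) :
    (diagT ind * A) i j = LaurentPolynomial.T (ind i) * A i j :=
  Matrix.diagonal_mul _ _ _ _

theorem mul_diagT_apply {n : ℕ} (ind : Fin n → ℤ)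
    (A : Matrix (Fin n) (Fin n) (LaurentPolynomial ℝ)) (i j : Fin n) :
    (A * diagT ind) i j = LaurentPolynomial.T (ind j) * A i j :=
  (Matrix.mul_diagonal _ _ _ _).trans (mul_comm _ _)

/-! ### Transition matrices and degree bounds -/

namespace IsWHF

variable {n : ℕ} {b : Matrix (Fin n) (Fin n) ℝ[X]} {W W' : FactorTriple n}

theorem factor_eq (h : IsWHF b W) :
    toLaurent.mapMatrix b =
      toLaurent.mapMatrix W.p * diagT W.ind * toLaurentInv.mapMatrix W.f :=
  h.factor

theorem aeval_det_p_ne_zero (h : IsWHF b W) (z : ℂ) (hz : ‖z‖ ≤ 1) : aeval z W.p.det ≠ 0 := by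
  rw [← det_evalMatrix]
  exact h.p_no_zero z hz

theorem aeval_det_f_ne_zero (h : IsWHF b W) (z : ℂ) (hz : 1 ≤ ‖z‖) : aeval z⁻¹ W.f.det ≠ 0 := by
  rw [← det_evalMatrix]
  exact h.f_no_zero z hz

theorem coeff_det_f_ne_zero (h : IsWHF b W) : W.f.det.coeff 0 ≠ 0 := by
  rw [← det_coeffMatrix_zero]
  exact h.f_no_zero_infty

theorem coeff_det_p_ne_zero (h : IsWHF b W) : W.p.det.coeff 0 ≠ 0 := by
  have := h.aeval_det_p_ne_zero 0 (by simp)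
  rw [coeff_zero_eq_aeval_zero]
  intro h0
  apply this
  rw [aeval_def, eval₂_at_zero, coeff_zero_eq_aeval_zero, h0, map_zero]

theorem det_p_ne_zero (h : IsWHF b W) : W.p.det ≠ 0 := fun h0 =>
  h.coeff_det_p_ne_zero (by rw [h0, coeff_zero])

theorem isUnit_coeffMatrix_p (h : IsWHF b W) : IsUnit (coeffMatrix W.p 0) := by
  rw [Matrix.isUnit_iff_isUnit_det, det_coeffMatrix_zero]
  exact h.coeff_det_p_ne_zero.isUnit

/-- The factor `p` and the partial indices determine a Wiener–Hopf factorisation. -/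
theorem ext_of_p_eq (h : IsWHF b W) (h' : IsWHF b W') (hp : W.p = W'.p) (hi : W.ind = W'.ind) :
    W = W' := by
  have e := h.factor_eq.symm.trans h'.factor_eq
  rw [← hp, ← hi, mul_assoc, mul_assoc] at e
  have hd : (toLaurent.mapMatrix W.p).det ≠ 0 := by
    rw [← RingHom.map_det]
    exact toLaurent_ne_zero.2 h.det_p_ne_zero
  have e1 := congrArg (diagT (-W.ind) * ·) (Matrix.mul_left_cancel_of_det_ne_zero hd e)
  simp only [← mul_assoc, diagT_neg_mul, one_mul] at e1
  have hf : W.f = W'.f := by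
    ext1 i j
    exact LaurentPolynomial.toLaurentInv_injective (congrFun (congrFun e1 i) j)
  cases W
  cases W'
  simp_all

/-- Two Wiener–Hopf factorisations of the same matrix differ by a polynomial matrix whose entries
have degrees bounded by the differences of the partial indices. -/
theorem exists_transition (h : IsWHF b W) (h' : IsWHF b W') :
    ∃ U : Matrix (Fin n) (Fin n) ℝ[X], W.p = W'.p * U ∧
      ∀ i j, ∀ m : ℕ, W'.ind i - W.ind j < m → (U i j).coeff m = 0 := by
  set P := toLaurent.mapMatrix W.p with hP
  set P' := toLaurent.mapMatrix W'.p with hP'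
  set F := toLaurentInv.mapMatrix W.f with hF
  set F' := toLaurentInv.mapMatrix W'.f with hF'
  have hdF : F.det = toLaurentInv W.f.det := (RingHom.map_det _ _).symm
  have hdP' : P'.det = toLaurent W'.p.det := (RingHom.map_det _ _).symm
  have e : P * diagT W.ind * F = P' * diagT W'.ind * F' := h.factor_eq.symm.trans h'.factor_eq
  -- This is p'⁻¹p = s' f' f⁻¹ s⁻¹ with the inverses replaced by adjugates, since p' and f need not
  -- be invertible over the Laurent ring.
  have e1 : diagT (-W'.ind) * (P'.adjugate * P * diagT W.ind) * (F.det • 1) =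
      P'.det • (F' * F.adjugate) := by
    calc _ = diagT (-W'.ind) * P'.adjugate * (P * diagT W.ind * F) * F.adjugate := by
            rw [← Matrix.mul_adjugate]; simp only [mul_assoc]
      _ = diagT (-W'.ind) * (P'.adjugate * P') * diagT W'.ind * F' * F.adjugate := by
            rw [e]; simp only [mul_assoc]
      _ = _ := by
            rw [Matrix.adjugate_mul]
            simp only [Matrix.mul_smul, Matrix.smul_mul, mul_one, diagT_neg_mul, one_mul]
  have hN : P'.adjugate * P = toLaurent.mapMatrix (W'.p.adjugate * W.p) := by
    rw [map_mul, RingHom.map_adjugate]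
  have hM : F' * F.adjugate = toLaurentInv.mapMatrix (W'.f * W.f.adjugate) := by
    rw [map_mul, RingHom.map_adjugate]
  have e2 : ∀ i j, toLaurent ((W'.p.adjugate * W.p) i j) *
      (LaurentPolynomial.T (W.ind j - W'.ind i) * toLaurentInv W.f.det) =
      toLaurent W'.p.det * toLaurentInv ((W'.f * W.f.adjugate) i j) := by
    intro i j
    have := congrFun (congrFun e1 i) j
    rw [hN, hM, Matrix.mul_smul, mul_one, Matrix.smul_apply, Matrix.smul_apply, diagT_mul_apply,
      mul_diagT_apply, hdF, hdP', smul_eq_mul, smul_eq_mul, RingHom.mapMatrix_apply,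
      RingHom.mapMatrix_apply, Matrix.map_apply, Matrix.map_apply] at this
    rw [← this, LaurentPolynomial.T_sub, Pi.neg_apply]
    ring
  have hdvd : ∀ i j, W'.p.det ∣ (W'.p.adjugate * W.p) i j := fun i j =>
    LaurentPolynomial.dvd_of_toLaurent_mul_toLaurentInv h'.aeval_det_p_ne_zero
      h.aeval_det_f_ne_zero (e2 i j)
  choose U hU using hdvd
  have hU' : W'.p.adjugate * W.p = W'.p.det • Matrix.of U := by
    ext1 i j
    rw [hU]
    rfl
  refine ⟨Matrix.of U, ?_, ?_⟩
  · have := congrArg (W'.p * ·) hU'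
    simp only [← mul_assoc, Matrix.mul_adjugate, Matrix.smul_mul, one_mul, Matrix.mul_smul] at this
    exact smul_right_injective _ h'.det_p_ne_zero this
  · intro i j m hm
    have e3 := e2 i j
    rw [hU, map_mul, mul_assoc] at e3
    have e4 := mul_left_cancel₀ (toLaurent_ne_zero.2 h'.det_p_ne_zero) e3
    -- Dividing by det f, whose value at infinity is nonzero, keeps the entry a polynomial in z⁻¹;
    -- that is the degree bound on U.
    obtain ⟨g, hg⟩ := LaurentPolynomial.exists_eq_toLaurentInv_of_toLaurentInv_mul
      (x := toLaurent (U i j) * LaurentPolynomial.T (W.ind j - W'.ind i))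
      h.coeff_det_f_ne_zero (by rw [← e4]; ring)
    have e5 := congrArg LaurentPolynomial.invert hg
    rw [map_mul, LaurentPolynomial.invert_T, LaurentPolynomial.invert_toLaurentInv, mul_comm,
      ← LaurentPolynomial.toLaurentInv_apply] at e5
    exact LaurentPolynomial.coeff_eq_zero_of_T_mul_toLaurentInv_eq e5 (by omega)

/-- The entries of `f` in row `i` have degree at most `ind i` in `z⁻¹`. -/
theorem coeff_f_eq_zero (h : IsWHF b W) (i j : Fin n) {m : ℕ} (hm : W.ind i < m) :
    (W.f i j).coeff m = 0 := by
  -- adj(p) b = det p · s f has no pole at 0 and det p(0) ≠ 0, so s f is polynomial in z.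
  have e := congrArg ((toLaurent.mapMatrix W.p).adjugate * ·) h.factor_eq
  simp only [← mul_assoc, Matrix.adjugate_mul, Matrix.smul_mul, one_mul] at e
  rw [← RingHom.map_adjugate, ← map_mul, ← RingHom.map_det] at e
  have e1 := congrFun (congrFun e i) j
  rw [Matrix.smul_apply, diagT_mul_apply, smul_eq_mul] at e1
  obtain ⟨g, hg⟩ :=
    LaurentPolynomial.exists_eq_toLaurent_of_toLaurent_mul h.coeff_det_p_ne_zero e1.symm
  exact LaurentPolynomial.coeff_eq_zero_of_T_mul_toLaurentInv_eq hg hm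

/-- The reversal `c` of `p s` with respect to degree `q` is a polynomial matrix with constant term
`b_q f_0⁻¹`. -/
theorem exists_reversal (h : IsWHF b W) {q : ℕ} (hq : HasMatrixDegree b q) :
    ∃ c : Matrix (Fin n) (Fin n) ℝ[X],
      (∀ i j, LaurentPolynomial.T (q - W.ind j) * toLaurentInv (W.p i j) = toLaurent (c i j)) ∧
      coeffMatrix b q = coeffMatrix c 0 * coeffMatrix W.f 0 := by
  have hb : ∀ i j, ∃ r : ℝ[X],
      LaurentPolynomial.T (q : ℤ) * toLaurentInv (b i j) = toLaurent r := fun i j =>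
    LaurentPolynomial.exists_T_mul_toLaurentInv_eq fun m hm =>
      congrFun (congrFun (hq.1 m (by exact_mod_cast hm)) i) j
  choose r hr using hb
  set I := (LaurentPolynomial.invert (R := ℝ)).toRingEquiv.toRingHom with hI
  have hdiag : I.mapMatrix (diagT W.ind) = diagT (-W.ind) := by
    ext1 i j
    rw [RingHom.mapMatrix_apply, Matrix.map_apply, diagT, diagT, Matrix.diagonal_apply,
      Matrix.diagonal_apply]
    split_ifs
    · exact LaurentPolynomial.invert_T _
    · exact map_zero I
  have hf : I.mapMatrix (toLaurentInv.mapMatrix W.f) = toLaurent.mapMatrix W.f := by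
    ext1 i j
    exact LaurentPolynomial.invert_toLaurentInv _
  set Y := (LaurentPolynomial.T (q : ℤ) : LaurentPolynomial ℝ) •
    (toLaurentInv.mapMatrix W.p * diagT (-W.ind)) with hY
  -- The factorisation after z ↦ z⁻¹ and multiplication by z^q: the reversal of b and f are now both
  -- polynomial in z, and only Y could have a pole at 0.
  have e : toLaurent.mapMatrix (Matrix.of r) = Y * toLaurent.mapMatrix W.f := by
    have e := congrArg I.mapMatrix h.factor_eq
    rw [map_mul, map_mul, hdiag, hf] at e
    have e' : toLaurentInv.mapMatrix b =
        toLaurentInv.mapMatrix W.p * diagT (-W.ind) * toLaurent.mapMatrix W.f := e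
    rw [hY, Matrix.smul_mul, ← e']
    ext1 i j
    exact (hr i j).symm
  have e1 : toLaurent.mapMatrix (Matrix.of r * W.f.adjugate) = toLaurent W.f.det • Y := by
    rw [map_mul, RingHom.map_adjugate, e, mul_assoc, Matrix.mul_adjugate, Matrix.mul_smul, mul_one,
      RingHom.map_det]
  have hc : ∀ i j, ∃ c : ℝ[X], Y i j = toLaurent c := fun i j =>
    LaurentPolynomial.exists_eq_toLaurent_of_toLaurent_mul h.coeff_det_f_ne_zero
      (congrFun (congrFun e1 i) j).symm
  choose c hc using hc
  refine ⟨Matrix.of c, fun i j => ?_, ?_⟩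
  · rw [Matrix.of_apply, ← hc, hY, Matrix.smul_apply, mul_diagT_apply, smul_eq_mul,
      LaurentPolynomial.T_sub, mul_assoc]
    rfl
  · have hY' : Y = toLaurent.mapMatrix (Matrix.of c) := by
      ext1 i j
      exact hc i j
    rw [hY', ← map_mul] at e
    have e2 : Matrix.of r = Matrix.of c * W.f := by
      ext1 i j
      exact toLaurent_injective (congrFun (congrFun e i) j)
    rw [← coeffMatrix_zero_mul, ← e2]
    ext i j
    exact (LaurentPolynomial.coeff_eq_coeff_of_T_mul_toLaurentInv_eq (hr i j) (by simp)).symm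

/-- Partial indices are at most the degree of `b`. -/
theorem ind_le (h : IsWHF b W) {q : ℕ} (hq : HasMatrixDegree b q) (j : Fin n) : W.ind j ≤ q := by
  by_contra! hj
  obtain ⟨c, hc, -⟩ := h.exists_reversal hq
  -- An index above q would make the degree bound of column j of p negative, so that column would
  -- vanish.
  refine h.det_p_ne_zero (Matrix.det_eq_zero_of_column_eq_zero j fun i => ?_)
  ext m
  rw [coeff_zero]
  exact LaurentPolynomial.coeff_eq_zero_of_T_mul_toLaurentInv_eq (hc i j) (by omega)

/-- The degree of column `j` of `p` is at most `q - ind j`. -/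
theorem coeff_p_eq_zero (h : IsWHF b W) {q : ℕ} (hq : HasMatrixDegree b q) (i j : Fin n) {m : ℕ}
    (hm : q - W.ind j < m) : (W.p i j).coeff m = 0 := by
  obtain ⟨c, hc, -⟩ := h.exists_reversal hq
  exact LaurentPolynomial.coeff_eq_zero_of_T_mul_toLaurentInv_eq (hc i j) hm

/-- The leading column coefficients of `p` form the matrix `b_q f_0⁻¹`. -/
theorem coeffMatrix_eq_leading_mul (h : IsWHF b W) {q : ℕ} (hq : HasMatrixDegree b q)
    {d : Fin n → ℕ} (hd : ∀ j, (d j : ℤ) = q - W.ind j) :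
    coeffMatrix b q = Matrix.of (fun i j => (W.p i j).coeff (d j)) * coeffMatrix W.f 0 := by
  obtain ⟨c, hc, hb⟩ := h.exists_reversal hq
  rw [hb]
  congr 1
  ext i j
  exact LaurentPolynomial.coeff_eq_coeff_of_T_mul_toLaurentInv_eq (hc i j)
    (by rw [hd j, Nat.cast_zero, zero_add])

end IsWHF

/-! ### Uniqueness of the partial indices and change of factorisation -/

/-- A square matrix over a commutative ring with an `(n - m) × (m + 1)` block of zeros is
singular. -/
theorem Matrix.det_eq_zero_of_zero_block {R : Type*} [CommRing R] {n : ℕ}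
    (A : Matrix (Fin n) (Fin n) R) (m : Fin n) (hA : ∀ i j, m ≤ i → j ≤ m → A i j = 0) :
    A.det = 0 := by
  rw [Matrix.det_apply]
  refine Finset.sum_eq_zero fun σ _ => ?_
  -- Pigeonhole: σ cannot inject the m + 1 positions up to m into the m positions below it, so every
  -- term of the Leibniz sum meets the zero block.
  obtain ⟨j, hj, hσ⟩ : ∃ j, j ≤ m ∧ m ≤ σ j := by
    by_contra! hcon
    have := Finset.card_le_card_of_injOn (s := Finset.Iic m) (t := Finset.Iio m) σ
      (fun j hj => by simpa using hcon j (by simpa using hj)) σ.injective.injOn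
    simp at this
  have h0 : ∏ i, A (σ i) i = 0 := Finset.prod_eq_zero (Finset.mem_univ j) (hA _ _ hσ hj)
  rw [h0, smul_zero]

namespace IsWHF

variable {n : ℕ} {b : Matrix (Fin n) (Fin n) ℝ[X]} {W W' : FactorTriple n}

/-- By monotonicity, a violation at m makes the degree bound on the transition matrix negative for
all rows from m on and all columns up to m, which forces its determinant to vanish. -/
theorem ind_le_ind (h : IsWHF b W) (h' : IsWHF b W') (m : Fin n) : W.ind m ≤ W'.ind m := by
  by_contra! hm
  obtain ⟨U, hU, hdeg⟩ := h.exists_transition h'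
  refine h.det_p_ne_zero ?_
  rw [hU, Matrix.det_mul, Matrix.det_eq_zero_of_zero_block U m, mul_zero]
  intro i j hi hj
  ext l
  have h1 := h.antitone_ind hj
  have h2 := h'.antitone_ind hi
  exact hdeg i j l (by omega)

/-- The partial indices are determined by the matrix. -/
theorem ind_eq (h : IsWHF b W) (h' : IsWHF b W') : W.ind = W'.ind :=
  funext fun m => le_antisymm (h.ind_le_ind h' m) (h'.ind_le_ind h m)

/-- Multiplying `p` on the right by a polynomial matrix that is invertible within the degree bounds
given by the partial indices yields another Wiener–Hopf factorisation. -/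
theorem exists_p_mul (h : IsWHF b W) {U V : Matrix (Fin n) (Fin n) ℝ[X]} (hUV : U * V = 1)
    (hU : ∀ i j, ∀ m : ℕ, W.ind i - W.ind j < m → (U i j).coeff m = 0)
    (hV : ∀ i j, ∀ m : ℕ, W.ind i - W.ind j < m → (V i j).coeff m = 0) :
    ∃ W' : FactorTriple n, IsWHF b W' ∧ W'.p = W.p * U := by
  -- The new factorisation is (pU) s (s⁻¹U⁻¹s f). The degree bounds say that conjugation by s lands
  -- in polynomials in z⁻¹; applied to both U and V, this makes the conjugate of V invertible there,
  -- so the zero conditions on f survive.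
  have key : ∀ U : Matrix (Fin n) (Fin n) ℝ[X],
      (∀ i j, ∀ m : ℕ, W.ind i - W.ind j < m → (U i j).coeff m = 0) →
      ∃ G : Matrix (Fin n) (Fin n) ℝ[X],
        diagT (-W.ind) * toLaurent.mapMatrix U * diagT W.ind = toLaurentInv.mapMatrix G := by
    intro U hU
    have : ∀ i j, ∃ g : ℝ[X],
        LaurentPolynomial.T (W.ind j - W.ind i) * toLaurent (U i j) = toLaurentInv g := fun i j =>
      LaurentPolynomial.exists_T_mul_toLaurent_eq fun m hm => hU i j m (by omega)
    choose g hg using this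
    refine ⟨Matrix.of g, ?_⟩
    ext1 i j
    rw [mul_diagT_apply, diagT_mul_apply, ← mul_assoc, ← LaurentPolynomial.T_add, Pi.neg_apply,
      ← sub_eq_add_neg]
    exact hg i j
  obtain ⟨G, hG⟩ := key V hV
  obtain ⟨H, hH⟩ := key U hU
  have hUV' : toLaurent.mapMatrix U * toLaurent.mapMatrix V = 1 := by rw [← map_mul, hUV, map_one]
  have hHG : H * G = 1 := by
    have : toLaurentInv.mapMatrix (H * G) = toLaurentInv.mapMatrix 1 := by
      rw [map_mul, ← hG, ← hH, map_one]
      calc _ = diagT (-W.ind) * toLaurent.mapMatrix U * (diagT W.ind * diagT (-W.ind)) *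
              toLaurent.mapMatrix V * diagT W.ind := by simp only [mul_assoc]
        _ = diagT (-W.ind) * (toLaurent.mapMatrix U * toLaurent.mapMatrix V) * diagT W.ind := by
              rw [diagT_mul_neg, mul_one]; simp only [mul_assoc]
        _ = 1 := by rw [hUV', mul_one, diagT_neg_mul]
    ext1 i j
    exact LaurentPolynomial.toLaurentInv_injective (congrFun (congrFun this i) j)
  have hUdet : IsUnit U.det := IsUnit.of_mul_eq_one V.det
    (by rw [← Matrix.det_mul, hUV, Matrix.det_one])
  have hGdet : IsUnit G.det := IsUnit.of_mul_eq_one H.det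
    (by rw [mul_comm, ← Matrix.det_mul, hHG, Matrix.det_one])
  refine ⟨⟨W.p * U, W.ind, G * W.f⟩, ⟨?_, h.antitone_ind, ?_, ?_, ?_⟩, rfl⟩
  · change toLaurent.mapMatrix b = toLaurent.mapMatrix (W.p * U) * diagT W.ind *
      toLaurentInv.mapMatrix (G * W.f)
    rw [map_mul, map_mul, ← hG, h.factor_eq]
    symm
    calc _ = toLaurent.mapMatrix W.p * toLaurent.mapMatrix U * (diagT W.ind * diagT (-W.ind)) *
            toLaurent.mapMatrix V * diagT W.ind * toLaurentInv.mapMatrix W.f := by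
              simp only [mul_assoc]
      _ = toLaurent.mapMatrix W.p * (toLaurent.mapMatrix U * toLaurent.mapMatrix V) *
            diagT W.ind * toLaurentInv.mapMatrix W.f := by
              rw [diagT_mul_neg, mul_one]; simp only [mul_assoc]
      _ = _ := by rw [hUV', mul_one]
  · intro z hz
    rw [det_evalMatrix, Matrix.det_mul, map_mul]
    exact mul_ne_zero (h.aeval_det_p_ne_zero z hz) (hUdet.map (aeval z)).ne_zero
  · intro z hz
    rw [det_evalMatrix, Matrix.det_mul, map_mul]
    exact mul_ne_zero (hGdet.map (aeval z⁻¹)).ne_zero (h.aeval_det_f_ne_zero z hz)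
  · rw [det_coeffMatrix_zero, Matrix.det_mul, mul_coeff_zero]
    exact mul_ne_zero (hGdet.map constantCoeff).ne_zero h.coeff_det_f_ne_zero

/-- Permuting the rows of `b` permutes the rows of `p`. -/
theorem submatrix (h : IsWHF b W) (σ : Equiv.Perm (Fin n)) :
    IsWHF (b.submatrix σ id) ⟨W.p.submatrix σ id, W.ind, W.f⟩ where
  factor := by
    have := congrArg (fun A => A.submatrix σ id) h.factor
    ext1 i j
    exact congrFun (congrFun this i) j
  antitone_ind := h.antitone_ind
  p_no_zero z hz := by
    rw [det_evalMatrix, Matrix.det_permute, map_mul]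
    refine mul_ne_zero ?_ (h.aeval_det_p_ne_zero z hz)
    rcases Int.units_eq_one_or (Equiv.Perm.sign σ) with h | h <;> simp [h]
  f_no_zero := h.f_no_zero
  f_no_zero_infty := h.f_no_zero_infty

end IsWHF

/-! ### Linear algebra of the normalisation -/

/-- Block triangular reduction relative to an idempotent `e`: if `x` and `e x + (1 - e)` are
invertible, then `x` can be brought to the normal form `e x u = e`, `(1 - e) x u (1 - e) = 1 - e`
by an invertible block upper triangular `u`. -/
theorem exists_upper_triangular_normalisation {R : Type*} [Ring R] {e x : R} (he : e * e = e)
    (hx : IsUnit x) (hq : IsUnit (e * x + (1 - e))) :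
    ∃ u v : R, u * v = 1 ∧ (1 - e) * u * e = 0 ∧ (1 - e) * v * e = 0 ∧ e * (x * u) = e ∧
      (1 - e) * (x * u) * (1 - e) = 1 - e := by
  obtain ⟨y, hxy, hyx⟩ := isUnit_iff_exists.1 hx
  obtain ⟨t, hqt, htq⟩ := isUnit_iff_exists.1 hq
  set q := e * x + (1 - e) with hq'
  set f := 1 - e with hf
  clear_value f
  have hef : e * f = 0 := by rw [hf, mul_sub, mul_one, he, sub_self]
  have hfe : f * e = 0 := by rw [hf, sub_mul, one_mul, he, sub_self]
  have hff : f * f = f := by nth_rw 2 [hf]; rw [mul_sub, mul_one, hfe, sub_zero]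
  have heq : e * q = e * x := by rw [hq', mul_add, ← mul_assoc, he, hef, add_zero]
  have hfq : f * q = f := by rw [hq', mul_add, ← mul_assoc, hfe, zero_mul, hff, zero_add]
  have hft : f * t = f := by nth_rw 1 [← hfq]; rw [mul_assoc, hqt, mul_one]
  have hext : e * (x * t) = e := by rw [← mul_assoc, ← heq, mul_assoc, hqt, mul_one]
  have h1 : x * t * (q * y) = 1 := by
    rw [mul_assoc, ← mul_assoc t, htq, one_mul, hxy]
  have h2 : q * y * (x * t) = 1 := by
    rw [mul_assoc, ← mul_assoc y, hyx, one_mul, hqt]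
  -- With e as first block, t is block upper triangular and `z` has upper row (1, 0). Its inverse
  -- `w` has the same shape, so the lower right corners of `z` and `w` are mutually inverse; the
  -- factor e + f w f normalises that corner.
  set z := x * t with hz
  set w := q * y with hw
  have hew : e * w = e := by nth_rw 1 [← hext]; rw [mul_assoc, h1, mul_one]
  have hfz : f * z = z - e := by rw [hf, sub_mul, one_mul, hext]
  have hfw : f * w = w - e := by rw [hf, sub_mul, one_mul, hew]
  have hzw : f * z * (f * w * f) = f := by
    rw [hfw, sub_mul, hef, sub_zero, mul_assoc, ← mul_assoc z, h1, one_mul, hff]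
  have hwz : f * w * (f * z * f) = f := by
    rw [hfz, sub_mul, hef, sub_zero, mul_assoc, ← mul_assoc w, h2, one_mul, hff]
  have hxu : x * (t * (e + f * w * f)) = z * (e + f * w * f) := (mul_assoc _ _ _).symm
  refine ⟨t * (e + f * w * f), (e + f * z * f) * q, ?_, ?_, ?_, ?_, ?_⟩
  · have : (e + f * w * f) * (e + f * z * f) = 1 := by
      rw [add_mul, mul_add, mul_add, he, mul_assoc (f * w) f e, hfe, mul_zero,
        mul_assoc (f * w) f, ← mul_assoc f (f * z) f, ← mul_assoc f f z, hff, hwz,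
        ← mul_assoc e, ← mul_assoc e, hef, hf]
      simp
    rw [mul_assoc, ← mul_assoc _ _ q, this, one_mul, htq]
  · rw [← mul_assoc, hft, mul_add, hfe, zero_add, mul_assoc, mul_assoc, hfe, mul_zero, mul_zero]
  · rw [add_mul, mul_assoc (f * z) f q, hfq, mul_add, ← mul_assoc, hfe, zero_mul, zero_add,
      mul_assoc, mul_assoc, hfe, mul_zero, mul_zero]
  · rw [hxu, ← mul_assoc, hext, mul_add, he, ← mul_assoc, ← mul_assoc, hef, zero_mul, zero_mul,
      add_zero]
  · rw [hxu, ← mul_assoc, mul_add, add_mul, hzw, mul_assoc (f * z) e f, hef, mul_zero, zero_add,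
      hff]

/-- The projection onto the first `k` coordinates. -/
def blockProj (n k : ℕ) : Matrix (Fin n) (Fin n) ℝ :=
  Matrix.diagonal fun i => if (i : ℕ) < k then 1 else 0

theorem blockProj_mul_self (n k : ℕ) : blockProj n k * blockProj n k = blockProj n k := by
  rw [blockProj, Matrix.diagonal_mul_diagonal]
  congr 1
  ext1 i
  split_ifs <;> simp

theorem blockProj_mul_apply {n : ℕ} (k : ℕ) (A : Matrix (Fin n) (Fin n) ℝ) (i j : Fin n) :
    (blockProj n k * A) i j = if (i : ℕ) < k then A i j else 0 := by
  rw [blockProj, Matrix.diagonal_mul]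
  split_ifs <;> simp

theorem mul_blockProj_apply {n : ℕ} (k : ℕ) (A : Matrix (Fin n) (Fin n) ℝ) (i j : Fin n) :
    (A * blockProj n k) i j = if (j : ℕ) < k then A i j else 0 := by
  rw [blockProj, Matrix.mul_diagonal]
  split_ifs <;> simp

theorem one_sub_blockProj_mul_apply {n : ℕ} (k : ℕ) (A : Matrix (Fin n) (Fin n) ℝ) (i j : Fin n) :
    ((1 - blockProj n k) * A) i j = if (i : ℕ) < k then 0 else A i j := by
  rw [sub_mul, one_mul, Matrix.sub_apply, blockProj_mul_apply]
  split_ifs <;> simp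

theorem mul_one_sub_blockProj_apply {n : ℕ} (k : ℕ) (A : Matrix (Fin n) (Fin n) ℝ) (i j : Fin n) :
    (A * (1 - blockProj n k)) i j = if (j : ℕ) < k then 0 else A i j := by
  rw [mul_sub, mul_one, Matrix.sub_apply, mul_blockProj_apply]
  split_ifs <;> simp

theorem blockProj_apply (n k : ℕ) (i j : Fin n) :
    blockProj n k i j = if (i : ℕ) < k then if i = j then 1 else 0 else 0 := by
  have := blockProj_mul_apply k (1 : Matrix (Fin n) (Fin n) ℝ) i j
  rwa [mul_one, Matrix.one_apply] at this

/-- Idempotent identities replace block matrices, so the normalisation can be handled in the ring of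
full-size matrices; the first identity carries both upper blocks of p_0. -/
theorem isNormalised_iff {n k : ℕ} {p : Matrix (Fin n) (Fin n) ℝ[X]} :
    IsNormalised k p ↔ blockProj n k * coeffMatrix p 0 = blockProj n k ∧
      (1 - blockProj n k) * coeffMatrix p 0 * (1 - blockProj n k) = 1 - blockProj n k ∧
      blockProj n k * coeffMatrix p 1 * (1 - blockProj n k) = 0 := by
  constructor
  · intro h
    refine ⟨?_, ?_, ?_⟩ <;> ext i j
    · rw [blockProj_mul_apply, blockProj_apply]
      split_ifs with hi hij
      · subst hij
        rw [h.p0_11 i i hi hi, if_pos rfl]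
      · rcases lt_or_ge (j : ℕ) k with hj | hj
        · rw [h.p0_11 i j hi hj, if_neg hij]
        · exact h.p0_12 i j hi hj
      · rfl
    · rw [mul_one_sub_blockProj_apply, one_sub_blockProj_mul_apply, Matrix.sub_apply,
        blockProj_apply, Matrix.one_apply]
      split_ifs with hj hi hij hij hi hij hij
      all_goals first
        | simp; done
        | (exfalso; subst_vars; omega)
        | (rw [h.p0_22 i j (by omega) (by omega)]; simp [hij])
    · rw [mul_one_sub_blockProj_apply, blockProj_mul_apply]
      split_ifs with hj hi
      · rfl
      · exact h.p1_12 i j hi (by omega)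
      · rfl
  · rintro ⟨h1, h2, h3⟩
    have e1 := fun i j => congrFun (congrFun h1 i) j
    have e2 := fun i j => congrFun (congrFun h2 i) j
    have e3 := fun i j => congrFun (congrFun h3 i) j
    simp only [mul_one_sub_blockProj_apply, one_sub_blockProj_mul_apply, blockProj_mul_apply,
      blockProj_apply, Matrix.sub_apply, Matrix.one_apply, Matrix.zero_apply] at e1 e2 e3
    refine ⟨fun i j hi hj => ?_, fun i j hi hj => ?_, fun i j hi hj => ?_, fun i j hi hj => ?_⟩
    · simpa [hi] using e1 i j
    · have hij : i ≠ j := by rintro rfl; omega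
      simpa [hi, hij] using e1 i j
    · simpa [hi.not_gt, hj.not_gt] using e2 i j
    · simpa [hi, hj.not_gt] using e3 i j

/-- The degree bounds on transition matrices for partial indices `(κ + 1, …, κ + 1, κ, …, κ)`. -/
theorem forall_coeff_eq_zero_indexPair_iff {n κ k : ℕ} {U : Matrix (Fin n) (Fin n) ℝ[X]} :
    (∀ i j, ∀ m : ℕ, indexPair n κ k i - indexPair n κ k j < m → (U i j).coeff m = 0) ↔
      (1 - blockProj n k) * coeffMatrix U 0 * blockProj n k = 0 ∧
      blockProj n k * coeffMatrix U 1 * (1 - blockProj n k) = coeffMatrix U 1 ∧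
      ∀ m, 2 ≤ m → coeffMatrix U m = 0 := by
  constructor
  · intro h
    refine ⟨?_, ?_, fun m hm => ?_⟩ <;> ext i j
    · rw [mul_blockProj_apply, one_sub_blockProj_mul_apply, Matrix.zero_apply]
      split_ifs with hj hi <;> try rfl
      exact h i j 0 (by simp [indexPair, hi, hj])
    · rw [mul_one_sub_blockProj_apply, blockProj_mul_apply]
      split_ifs with hj hi <;> try rfl
      · symm
        refine h i j 1 ?_
        simp only [indexPair, hj, if_true]
        split_ifs <;> simp
      · exact (h i j 1 (by simp [indexPair, hi, hj])).symm
    · refine h i j m ?_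
      simp only [indexPair]
      split_ifs <;> omega
  · rintro ⟨h0, h1, h2⟩ i j m hm
    have e0 := congrFun (congrFun h0 i) j
    have e1 := congrFun (congrFun h1 i) j
    simp only [mul_one_sub_blockProj_apply, one_sub_blockProj_mul_apply, blockProj_mul_apply,
      mul_blockProj_apply, Matrix.zero_apply, coeffMatrix_apply] at e0 e1
    rcases Nat.lt_or_ge m 2 with hm2 | hm2
    · simp only [indexPair] at hm
      interval_cases m <;> split_ifs at hm e0 e1 <;> first | exact e0 | exact e1.symm | omega
    · exact congrFun (congrFun (h2 m hm2) i) j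

theorem eq_of_coeffMatrix {n : ℕ} {A B : Matrix (Fin n) (Fin n) ℝ[X]}
    (h : ∀ m, coeffMatrix A m = coeffMatrix B m) : A = B := by
  ext i j m
  exact congrFun (congrFun (h m) i) j

/-- The determinant of a leading block as the determinant of a full-size matrix. -/
theorem det_blockProj_mul_add {n k : ℕ} (hk : k ≤ n) (A : Matrix (Fin n) (Fin n) ℝ) :
    (blockProj n k * A + (1 - blockProj n k)).det = (leadingBlock k hk A).det := by
  have hent : ∀ i j, (blockProj n k * A + (1 - blockProj n k)) i j =
      if (i : ℕ) < k then A i j else if i = j then 1 else 0 := by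
    intro i j
    rw [Matrix.add_apply, Matrix.sub_apply, blockProj_mul_apply, blockProj_apply, Matrix.one_apply]
    split_ifs <;> simp
  rw [Matrix.twoBlockTriangular_det _ (fun i : Fin n => (i : ℕ) < k)]
  · let φ : Fin k ≃ {i : Fin n // (i : ℕ) < k} :=
      { toFun := fun i => ⟨Fin.castLE hk i, i.2⟩
        invFun := fun i => ⟨i.1, i.2⟩
        left_inv := fun _ => rfl
        right_inv := fun _ => rfl }
    have h2 : Matrix.toSquareBlockProp (blockProj n k * A + (1 - blockProj n k))
        (fun i : Fin n => ¬ (i : ℕ) < k) = 1 := by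
      ext i j
      rw [Matrix.toSquareBlockProp_def, Matrix.of_apply, hent, if_neg i.2, Matrix.one_apply]
      exact if_congr Subtype.ext_iff.symm rfl rfl
    rw [h2, Matrix.det_one, mul_one, ← Matrix.det_submatrix_equiv_self φ]
    congr 1
    ext i j
    rw [Matrix.submatrix_apply, Matrix.toSquareBlockProp_def, Matrix.of_apply, hent, if_pos (φ i).2]
    rfl
  · intro i hi j hj
    rw [hent, if_neg hi, if_neg]
    rintro rfl
    exact hi hj

/-- The rows of an invertible matrix can be permuted so that the leading `k × k` block becomes
invertible. -/
theorem exists_perm_det_leadingBlock_ne_zero {n k : ℕ} (hk : k ≤ n)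
    {A : Matrix (Fin n) (Fin n) ℝ} (hA : IsUnit A) :
    ∃ σ : Equiv.Perm (Fin n), (leadingBlock k hk (A.submatrix σ id)).det ≠ 0 := by
  let v : Fin n → Fin k → ℝ := fun i j => A i (Fin.castLE hk j)
  obtain ⟨B, -, hB⟩ := isUnit_iff_exists.1 hA
  -- The first k rows of `B * A = 1` write each standard basis vector as a combination of the
  -- truncated rows of A. A basis selected among those rows supplies the new leading rows.
  have hspan : Submodule.span ℝ (Set.range v) = ⊤ := by
    rw [← (Pi.basisFun ℝ (Fin k)).span_eq, eq_comm]
    refine le_antisymm (Submodule.span_le.2 ?_) ((Pi.basisFun ℝ (Fin k)).span_eq ▸ le_top)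
    rintro _ ⟨l, rfl⟩
    have : (Pi.basisFun ℝ (Fin k)) l = ∑ i, B (Fin.castLE hk l) i • v i := by
      ext j
      have := congrFun (congrFun hB (Fin.castLE hk l)) (Fin.castLE hk j)
      rw [Matrix.mul_apply, Matrix.one_apply] at this
      rw [Finset.sum_apply]
      simp only [Pi.basisFun_apply, Pi.smul_apply, smul_eq_mul, v, this, Pi.single_apply,
        Fin.castLE_inj]
      exact if_congr eq_comm rfl rfl
    rw [this]
    exact Submodule.sum_mem _ fun i _ =>
      Submodule.smul_mem _ _ (Submodule.subset_span (Set.mem_range_self i))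
  obtain ⟨ι, a, ha, hsp, hli⟩ := exists_linearIndependent' ℝ v
  have : Finite ι := Finite.of_injective a ha
  have : Fintype ι := Fintype.ofFinite ι
  rw [hspan] at hsp
  have hcard : Fintype.card ι = k := by
    have := Module.finrank_eq_card_basis (Module.Basis.mk hli hsp.ge)
    simpa using this.symm
  let ψ : Fin k ≃ ι := (Fintype.equivFinOfCardEq hcard).symm
  have hinj : Function.Injective (a ∘ ψ) := ha.comp ψ.injective
  let φ : {i : Fin n // (i : ℕ) < k} ≃ {i : Fin n // i ∈ Set.range (a ∘ ψ)} :=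
    Equiv.trans
      { toFun := fun i => ⟨i.1, i.2⟩
        invFun := fun i => ⟨Fin.castLE hk i, i.2⟩
        left_inv := fun _ => rfl
        right_inv := fun _ => rfl }
      (Equiv.ofInjective (a ∘ ψ) hinj)
  classical
  refine ⟨φ.extendSubtype, ?_⟩
  have hφ : ∀ i : Fin k, φ.extendSubtype (Fin.castLE hk i) = a (ψ i) := fun i =>
    φ.extendSubtype_apply_of_mem _ i.2
  have hli' : LinearIndependent ℝ (leadingBlock k hk (A.submatrix φ.extendSubtype id)).row := by
    have : (leadingBlock k hk (A.submatrix φ.extendSubtype id)).row = (v ∘ a) ∘ ψ := by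
      ext i j
      change A (φ.extendSubtype (Fin.castLE hk i)) _ = A (a (ψ i)) _
      rw [hφ]
      rfl
    rw [this]
    exact hli.comp _ ψ.injective
  rw [Matrix.linearIndependent_rows_iff_isUnit, Matrix.isUnit_iff_isUnit_det] at hli'
  exact hli'.ne_zero

theorem coeffMatrix_mapMatrix_C {n : ℕ} (A : Matrix (Fin n) (Fin n) ℝ) (m : ℕ) :
    coeffMatrix ((Polynomial.C : ℝ →+* ℝ[X]).mapMatrix A) m = if m = 0 then A else 0 := by
  ext i j
  rw [coeffMatrix_apply, RingHom.mapMatrix_apply, Matrix.map_apply, coeff_C]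
  split_ifs <;> rfl

theorem coeffMatrix_one_add_X_smul {n : ℕ} (A : Matrix (Fin n) (Fin n) ℝ) (m : ℕ) :
    coeffMatrix (1 + (X : ℝ[X]) • (Polynomial.C : ℝ →+* ℝ[X]).mapMatrix A) m =
      if m = 0 then 1 else if m = 1 then A else 0 := by
  ext i j
  rw [coeffMatrix_apply, Matrix.add_apply, Matrix.smul_apply, RingHom.mapMatrix_apply,
    Matrix.map_apply, smul_eq_mul, coeff_add, Matrix.one_apply]
  rcases m with _ | _ | m
  · simp [Matrix.one_apply, apply_ite (fun q : ℝ[X] => q.coeff 0)]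
  · simp [apply_ite (fun q : ℝ[X] => q.coeff 1), coeff_one]
  · simp [apply_ite (fun q : ℝ[X] => q.coeff (m + 1 + 1)), coeff_one]

/-! ### Canonical factorisations -/

namespace IsWHF

variable {n κ k : ℕ} {b : Matrix (Fin n) (Fin n) ℝ[X]} {V V' W : FactorTriple n}

/-- The group action has trivial stabiliser on normal forms: the conditions on p_0 force U_0 = 1,
and then equality of the two blocks p_{1,12} forces U_1 = 0. -/
theorem isNormalised_unique (hW : IsWHF b W) (hi : W.ind = indexPair n κ k)
    (hV : IsWHF b V) (hVn : IsNormalised k V.p) (hV' : IsWHF b V') (hVn' : IsNormalised k V'.p) :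
    V = V' := by
  obtain ⟨U, hU, hdeg⟩ := hV.exists_transition hV'
  rw [hV'.ind_eq hW, hV.ind_eq hW, hi, forall_coeff_eq_zero_indexPair_iff] at hdeg
  obtain ⟨h0, h1, h2⟩ := hdeg
  rw [isNormalised_iff, hU, coeffMatrix_zero_mul, coeffMatrix_one_mul] at hVn
  rw [isNormalised_iff] at hVn'
  obtain ⟨a1, a2, a3⟩ := hVn
  obtain ⟨c1, c2, c3⟩ := hVn'
  set e := blockProj n k
  set U0 := coeffMatrix U 0
  set U1 := coeffMatrix U 1
  set Q0 := coeffMatrix V'.p 0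
  set Q1 := coeffMatrix V'.p 1
  have k1 : e * U0 = e := by rwa [← mul_assoc, c1] at a1
  have k2 : (1 - e) * U0 * (1 - e) = 1 - e := by
    have hsplit : Q0 * U0 * (1 - e) = Q0 * (e * U0) * (1 - e) + Q0 * ((1 - e) * U0 * (1 - e)) := by
      noncomm_ring
    have hee : e * (1 - e) = 0 := by rw [mul_sub, mul_one, blockProj_mul_self, sub_self]
    rw [mul_assoc, hsplit, k1, mul_assoc Q0 e, hee, mul_zero, zero_add] at a2
    calc (1 - e) * U0 * (1 - e) = (1 - e) * Q0 * (1 - e) * (U0 * (1 - e)) := by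
          rw [c2, mul_assoc]
      _ = (1 - e) * (Q0 * ((1 - e) * U0 * (1 - e))) := by simp only [mul_assoc]
      _ = 1 - e := a2
  have hU0 : U0 = 1 := by
    calc U0 = e * U0 + (1 - e) * U0 * e + (1 - e) * U0 * (1 - e) := by noncomm_ring
      _ = 1 := by rw [k1, h0, k2]; abel
  have hU1 : U1 = 0 := by
    have := a3
    rw [hU0, mul_one, mul_add, add_mul, c3, add_zero, ← mul_assoc, c1, h1] at this
    exact this
  have : U = 1 := by
    refine eq_of_coeffMatrix fun m => ?_
    have h1m : ∀ m, coeffMatrix (1 : Matrix (Fin n) (Fin n) ℝ[X]) m = if m = 0 then 1 else 0 := by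
      intro m
      have := coeffMatrix_mapMatrix_C (1 : Matrix (Fin n) (Fin n) ℝ) m
      rwa [map_one] at this
    rw [h1m]
    rcases m with _ | _ | m
    · exact hU0
    · exact hU1
    · exact h2 _ (by omega)
  rw [this, mul_one] at hU
  exact hV.ext_of_p_eq hV' hU (hV.ind_eq hV')

/-- Two multipliers suffice: a constant block upper triangular one normalises p_0, then 1 − zN, with
N the upper right block of the resulting p_1, clears that block without touching p_0. Since N² = 0,
its inverse is 1 + zN. -/
theorem exists_isNormalised (hW : IsWHF b W) (hi : W.ind = indexPair n κ k)
    (hu : IsUnit (blockProj n k * coeffMatrix W.p 0 + (1 - blockProj n k))) :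
    ∃ V, IsWHF b V ∧ IsNormalised k V.p := by
  obtain ⟨u, v, huv, hu0, hv0, h1, h2⟩ :=
    exists_upper_triangular_normalisation (blockProj_mul_self n k) hW.isUnit_coeffMatrix_p hu
  have hC : ∀ A : Matrix (Fin n) (Fin n) ℝ, (1 - blockProj n k) * A * blockProj n k = 0 →
      ∀ i j, ∀ m : ℕ, indexPair n κ k i - indexPair n κ k j < m →
        (((Polynomial.C : ℝ →+* ℝ[X]).mapMatrix A) i j).coeff m = 0 := by
    intro A hA
    rw [forall_coeff_eq_zero_indexPair_iff]
    refine ⟨?_, ?_, fun m hm => ?_⟩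
    · rwa [coeffMatrix_mapMatrix_C, if_pos rfl]
    · rw [coeffMatrix_mapMatrix_C, if_neg one_ne_zero, mul_zero, zero_mul]
    · rw [coeffMatrix_mapMatrix_C, if_neg (by omega)]
  obtain ⟨W', hW', hp'⟩ := hW.exists_p_mul (U := (Polynomial.C : ℝ →+* ℝ[X]).mapMatrix u)
    (V := (Polynomial.C : ℝ →+* ℝ[X]).mapMatrix v) (by rw [← map_mul, huv, map_one])
    (by rw [hi]; exact hC u hu0) (by rw [hi]; exact hC v hv0)
  have hp0 : coeffMatrix W'.p 0 = coeffMatrix W.p 0 * u := by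
    rw [hp', coeffMatrix_zero_mul, coeffMatrix_mapMatrix_C, if_pos rfl]
  rw [← hp0] at h1 h2
  have hfe : (1 - blockProj n k) * blockProj n k = 0 := by
    rw [sub_mul, one_mul, blockProj_mul_self, sub_self]
  have hff : (1 - blockProj n k) * (1 - blockProj n k) = 1 - blockProj n k := by
    rw [mul_sub, mul_one, hfe, sub_zero]
  set N := blockProj n k * coeffMatrix W'.p 1 * (1 - blockProj n k) with hN
  have heN : blockProj n k * N = N := by
    rw [hN, ← mul_assoc, ← mul_assoc, blockProj_mul_self]
  have hNf : N * (1 - blockProj n k) = N := by rw [hN, mul_assoc, hff]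
  have hNN : N * N = 0 := by
    rw [← hNf, mul_assoc, hNf, ← heN, ← mul_assoc (1 - _), hfe, zero_mul, mul_zero]
  have hX : ∀ A : Matrix (Fin n) (Fin n) ℝ, blockProj n k * A * (1 - blockProj n k) = A →
      ∀ i j, ∀ m : ℕ, indexPair n κ k i - indexPair n κ k j < m →
        ((1 + (X : ℝ[X]) • (Polynomial.C : ℝ →+* ℝ[X]).mapMatrix A) i j).coeff m = 0 := by
    intro A hA
    rw [forall_coeff_eq_zero_indexPair_iff]
    simp only [coeffMatrix_one_add_X_smul]
    refine ⟨?_, hA, fun m hm => ?_⟩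
    · rw [if_pos trivial, mul_one, hfe]
    · rw [if_neg (by omega), if_neg (by omega)]
  have hi' : W'.ind = indexPair n κ k := (hW'.ind_eq hW).trans hi
  obtain ⟨V, hV, hVp⟩ := hW'.exists_p_mul
    (U := 1 + (X : ℝ[X]) • (Polynomial.C : ℝ →+* ℝ[X]).mapMatrix (-N))
    (V := 1 + (X : ℝ[X]) • (Polynomial.C : ℝ →+* ℝ[X]).mapMatrix N)
    (by
      rw [add_mul, one_mul, mul_add, mul_one, Matrix.smul_mul, Matrix.mul_smul, ← map_mul,
        neg_mul, hNN, map_neg, neg_zero, map_zero]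
      simp)
    (by rw [hi']; exact hX _ (by rw [mul_neg, heN, neg_mul, hNf]))
    (by rw [hi']; exact hX _ (by rw [heN, hNf]))
  refine ⟨V, hV, isNormalised_iff.2 ?_⟩
  rw [hVp, coeffMatrix_zero_mul, coeffMatrix_one_mul, coeffMatrix_one_add_X_smul,
    coeffMatrix_one_add_X_smul, if_pos rfl, if_neg one_ne_zero, if_pos rfl, mul_one, mul_one]
  refine ⟨h1, h2, ?_⟩
  rw [mul_add, add_mul, ← mul_assoc, h1, mul_neg, heN, neg_mul, hNf, ← hN, neg_add_cancel]

/-- Because U_0 is block upper triangular, the upper left block of the normalised p_0U_0 is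
p_{0,11}U_{0,11}; being the identity, it makes p_{0,11} invertible. -/
theorem isUnit_of_isNormalised (hW : IsWHF b W) (hi : W.ind = indexPair n κ k)
    (hV : IsWHF b V) (hVn : IsNormalised k V.p) :
    IsUnit (blockProj n k * coeffMatrix W.p 0 + (1 - blockProj n k)) := by
  obtain ⟨U, hU, hdeg⟩ := hV.exists_transition hW
  obtain ⟨T, hT, -⟩ := hW.exists_transition hV
  rw [hV.ind_eq hW, hi, forall_coeff_eq_zero_indexPair_iff] at hdeg
  have hUT : U * T = 1 := by
    refine Matrix.mul_left_cancel_of_det_ne_zero hW.det_p_ne_zero ?_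
    rw [← mul_assoc, ← hU, ← hT, mul_one]
  have hUT0 : coeffMatrix U 0 * coeffMatrix T 0 = 1 := by
    rw [← coeffMatrix_zero_mul, hUT, coeffMatrix_zero_eq, map_one]
  have hn := (isNormalised_iff.1 hVn).1
  rw [hU, coeffMatrix_zero_mul, ← mul_assoc] at hn
  have h0 := hdeg.1
  have hee := blockProj_mul_self n k
  set e := blockProj n k
  set P := coeffMatrix W.p 0
  set U0 := coeffMatrix U 0
  set T0 := coeffMatrix T 0
  refine IsUnit.of_mul_eq_one (U0 * (e + (1 - e) * T0)) ?_
  have hA : (e * P + (1 - e)) * U0 = e + (1 - e) * U0 := by rw [add_mul, hn]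
  have hfU : (1 - e) * U0 * (1 - e) = (1 - e) * U0 := by rw [mul_sub, mul_one, h0, sub_zero]
  calc (e * P + (1 - e)) * (U0 * (e + (1 - e) * T0))
      = (e + (1 - e) * U0) * (e + (1 - e) * T0) := by rw [← mul_assoc, hA]
    _ = e * e + (e - e * e) * T0 + (1 - e) * U0 * e + (1 - e) * U0 * (1 - e) * T0 := by
        noncomm_ring
    _ = 1 := by
        rw [hee, sub_self, zero_mul, add_zero, h0, add_zero, hfU, mul_assoc, hUT0, mul_one]
        abel

theorem det_leadingBlock_ne_zero_iff (hW : IsWHF b W) (hi : W.ind = indexPair n κ k) (hk : k ≤ n) :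
    (leadingBlock k hk (coeffMatrix W.p 0)).det ≠ 0 ↔
      ∃! V : FactorTriple n, IsWHF b V ∧ IsNormalised k V.p := by
  rw [← det_blockProj_mul_add hk, ← isUnit_iff_ne_zero, ← Matrix.isUnit_iff_isUnit_det]
  constructor
  · intro hu
    obtain ⟨V, hV, hVn⟩ := hW.exists_isNormalised hi hu
    exact ⟨V, ⟨hV, hVn⟩, fun V' h' => hW.isNormalised_unique hi h'.1 h'.2 hV hVn⟩
  · rintro ⟨V, ⟨hV, hVn⟩, -⟩
    exact hW.isUnit_of_isNormalised hi hV hVn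

/-- The coefficients of p at the column bounds form a matrix L with b_q = L f_0, so L inherits being
nonzero, or having no zero column, from b_q. -/
theorem exists_column_ne_zero (hW : IsWHF b W) {q : ℕ} (hq : HasMatrixDegree b q)
    {d : Fin n → ℕ} (hd : ∀ j, (d j : ℤ) = q - W.ind j) :
    (∃ i j, (W.p i j).coeff (d j) ≠ 0) ∧
      ((coeffMatrix b q).det ≠ 0 → ∀ j, ∃ i, (W.p i j).coeff (d j) ≠ 0) := by
  have h := hW.coeffMatrix_eq_leading_mul hq hd
  constructor
  · by_contra! hc
    refine hq.2 ?_
    have h0 : Matrix.of (fun i j => (W.p i j).coeff (d j)) = 0 := by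
      ext i j
      exact hc i j
    rw [h, h0, zero_mul]
  · intro hdet j
    by_contra! hc
    refine hdet ?_
    rw [h, Matrix.det_mul, Matrix.det_eq_zero_of_column_eq_zero j hc, zero_mul]

end IsWHF

theorem isNormalised_zero_iff {n : ℕ} {p : Matrix (Fin n) (Fin n) ℝ[X]} :
    IsNormalised 0 p ↔ coeffMatrix p 0 = 1 := by
  have : blockProj n 0 = 0 := by simp [blockProj]
  rw [isNormalised_iff, this]
  simp

theorem mainTheorem1 (n q κ k : ℕ) (hk : k < n)
    (b : Matrix (Fin n) (Fin n) ℝ[X])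
    (hdeg : HasMatrixDegree b q)
    (hcircle : ∀ z : ℂ, ‖z‖ = 1 → (evalMatrix b z).det ≠ 0)
    (hind : ∃ W : FactorTriple n, IsWHF b W ∧ W.ind = indexPair n κ k) :
    -- all Wiener–Hopf factorisations of `b` have the same partial indices
    (∀ W : FactorTriple n, IsWHF b W → W.ind = indexPair n κ k) ∧
    -- the case `k = 0`
    (k = 0 →
      κ ≤ q ∧
      (∀ W : FactorTriple n, IsWHF b W →
        (∀ m : ℕ, q - κ < m → coeffMatrix W.p m = 0) ∧
        coeffMatrix W.p (q - κ) ≠ 0 ∧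
        (∀ m : ℕ, κ < m → coeffMatrix W.f m = 0)) ∧
      (∃! W : FactorTriple n, IsWHF b W ∧ coeffMatrix W.p 0 = 1)) ∧
    -- the case `k ≠ 0`
    (k ≠ 0 →
      κ + 1 ≤ q ∧
      (∀ W : FactorTriple n, IsWHF b W →
        -- degree bounds for the two column blocks of `p`
        (∀ m : ℕ, q - κ - 1 < m → ∀ i j : Fin n, (j : ℕ) < k → coeffMatrix W.p m i j = 0) ∧
        (∀ m : ℕ, q - κ < m → ∀ i j : Fin n, k ≤ (j : ℕ) → coeffMatrix W.p m i j = 0) ∧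
        -- at least one of the two bounds is attained
        ((∃ i j : Fin n, (j : ℕ) < k ∧ coeffMatrix W.p (q - κ - 1) i j ≠ 0) ∨
          (∃ i j : Fin n, k ≤ (j : ℕ) ∧ coeffMatrix W.p (q - κ) i j ≠ 0)) ∧
        -- and they are attained by every column if `b_q` is non-singular
        ((coeffMatrix b q).det ≠ 0 →
          (∀ j : Fin n, (j : ℕ) < k → ∃ i : Fin n, coeffMatrix W.p (q - κ - 1) i j ≠ 0) ∧
          (∀ j : Fin n, k ≤ (j : ℕ) → ∃ i : Fin n, coeffMatrix W.p (q - κ) i j ≠ 0)) ∧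
        -- degree of `f` in `z⁻¹`, and the vanishing block of its last coefficient
        (∀ m : ℕ, κ + 1 < m → coeffMatrix W.f m = 0) ∧
        (∀ i j : Fin n, k ≤ (i : ℕ) → coeffMatrix W.f (κ + 1) i j = 0) ∧
        -- the canonical representative exists, uniquely, if and only if `p_{0,11}` is invertible
        ((leadingBlock k hk.le (coeffMatrix W.p 0)).det ≠ 0 ↔
          ∃! V : FactorTriple n, IsWHF b V ∧ IsNormalised k V.p)) ∧
      -- there is never more than one canonical representative
      (∀ V V' : FactorTriple n, IsWHF b V → IsNormalised k V.p →
        IsWHF b V' → IsNormalised k V'.p → V = V') ∧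
      -- and after a suitable reordering of the rows of `b` there is exactly one
      (∃ σ : Equiv.Perm (Fin n), ∃! V : FactorTriple n,
        IsWHF (b.submatrix σ id) V ∧ IsNormalised k V.p)) := by
  obtain ⟨W₀, hW₀, hi₀⟩ := hind
  have hall : ∀ W : FactorTriple n, IsWHF b W → W.ind = indexPair n κ k := fun W hW =>
    (hW.ind_eq hW₀).trans hi₀
  have hind_lt : ∀ W : FactorTriple n, IsWHF b W → ∀ j : Fin n, (j : ℕ) < k →
      W.ind j = κ + 1 := fun W hW j hj => by rw [hall W hW, indexPair, if_pos hj]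
  have hind_ge : ∀ W : FactorTriple n, IsWHF b W → ∀ j : Fin n, k ≤ (j : ℕ) →
      W.ind j = κ := fun W hW j hj => by rw [hall W hW, indexPair, if_neg hj.not_gt]
  refine ⟨hall, ?_, ?_⟩
  · rintro rfl
    have hκ : κ ≤ q := by
      have h1 := hW₀.ind_le hdeg ⟨0, hk⟩
      rw [hind_ge W₀ hW₀ _ (Nat.zero_le _)] at h1
      exact_mod_cast h1
    refine ⟨hκ, fun W hW => ⟨fun m hm => ?_, fun h0 => ?_, fun m hm => ?_⟩, ?_⟩
    · ext i j
      have := hind_ge W hW j (Nat.zero_le _)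
      exact hW.coeff_p_eq_zero hdeg i j (by omega)
    · obtain ⟨i, j, hij⟩ := (hW.exists_column_ne_zero hdeg (d := fun _ => q - κ) fun j => by
        rw [hind_ge W hW j (Nat.zero_le _)]; omega).1
      exact hij (congrFun (congrFun h0 i) j)
    · ext i j
      have := hind_ge W hW i (Nat.zero_le _)
      exact hW.coeff_f_eq_zero i j (by omega)
    -- For k = 0 the leading block is empty with determinant 1, so the criterion for a canonical
    -- factorisation always holds.
    · have := (hW₀.det_leadingBlock_ne_zero_iff hi₀ hk.le).1
        (by rw [Matrix.det_fin_zero]; exact one_ne_zero)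
      simpa only [isNormalised_zero_iff] using this
  · intro hk0
    have hκ : κ + 1 ≤ q := by
      have h1 := hW₀.ind_le hdeg ⟨0, by omega⟩
      rw [hind_lt W₀ hW₀ _ (Nat.pos_of_ne_zero hk0)] at h1
      exact_mod_cast h1
    refine ⟨hκ, fun W hW => ?_, fun V V' hV hVn hV' hVn' =>
      hW₀.isNormalised_unique hi₀ hV hVn hV' hVn', ?_⟩
    -- The truncated subtractions are genuine because κ + 1 ≤ q.
    · obtain ⟨hex, hcol⟩ := hW.exists_column_ne_zero hdeg
        (d := fun j => if (j : ℕ) < k then q - κ - 1 else q - κ) fun j => by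
          split_ifs with hj
          · rw [hind_lt W hW j hj]; omega
          · rw [hind_ge W hW j (not_lt.1 hj)]; omega
      refine ⟨fun m hm i j hj => ?_, fun m hm i j hj => ?_, ?_, fun hdet => ⟨fun j hj => ?_,
        fun j hj => ?_⟩, fun m hm => ?_, fun i j hi => ?_,
        hW.det_leadingBlock_ne_zero_iff (hall W hW) hk.le⟩
      · have := hind_lt W hW j hj
        exact hW.coeff_p_eq_zero hdeg i j (by omega)
      · have := hind_ge W hW j hj
        exact hW.coeff_p_eq_zero hdeg i j (by omega)
      · obtain ⟨i, j, hij⟩ := hex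
        rcases lt_or_ge (j : ℕ) k with hj | hj
        · rw [if_pos hj] at hij
          exact Or.inl ⟨i, j, hj, hij⟩
        · rw [if_neg hj.not_gt] at hij
          exact Or.inr ⟨i, j, hj, hij⟩
      · simpa only [if_pos hj, coeffMatrix_apply] using hcol hdet j
      · simpa only [if_neg hj.not_gt, coeffMatrix_apply] using hcol hdet j
      · ext i j
        have h1 : W.ind i ≤ κ + 1 := by
          rw [hall W hW, indexPair]
          split_ifs <;> omega
        exact hW.coeff_f_eq_zero i j (by omega)
      · have := hind_ge W hW i hi
        exact hW.coeff_f_eq_zero i j (by push_cast; omega)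
    -- Permuting the rows of b permutes those of p and leaves s and f alone, so it is enough to move
    -- an invertible block of p_0 into leading position.
    · obtain ⟨σ, hσ⟩ := exists_perm_det_leadingBlock_ne_zero hk.le hW₀.isUnit_coeffMatrix_p
      exact ⟨σ, ((hW₀.submatrix σ).det_leadingBlock_ne_zero_iff hi₀ hk.le).1 hσ⟩
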